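/- Let $L,M>0$. Let $f:\mathbb R^d\to\mathbb R$ be $C^2$ with $L$-Lipschitz gradient and $M$-Lipschitz Hessian (spectral norm), and $f\ge \bar f$ everywhere. For tolerances $\epsilon_g,\epsilon_H>0$ and an upper bound $\alpha$ on negative-curvature step sizes, consider the following randomized algorithm started at $x_0$. At iteration $k=0,1,2,\dots$ it receives an approximate gradient $g_k$ and, * if $\|g_k\|>\epsilon_g$, sets $x_{k+1}=x_k-\frac1L g_k$; * otherwise it receives a symmetric approximate Hessian $H_k$ and a unit vector $\hat p_k$, and puts $\hat\lambda_k=\hat p_k^{T}H_k\hat p_k$. If $\hat\lambda_k<-\epsilon_H$, it sets $x_{k+1}=x_k+\frac{2\alpha_k}{M}\sigma_k\hat p_k$ with a step size $\alpha_k\in[\epsilon_H,\min(\alpha,|\hat\lambda_k|)]$ and a fair random sign $\sigma_k=\pm1$ independent of everything received or drawn before (including $g_k,H_k,\hat p_k$); if $\hat\lambda_k\ge-\epsilon_H$, it returns $x_k$ and stops. The quantities $g_k,H_k,\hat p_k$ may depend on the past and may be random. Assume that, almost surely, at all iterations up to termination, $$\|g_k-\nabla f(x_k)\|\le\tfrac13\max\{\epsilon_g,\|g_k\|\},\qquad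 \|H_k-\nabla^2f(x_k)\|\le\tfrac29\epsilon_H,\qquad |\hat\lambda_k-\lambda_{\min}(H_k)|\le\tfrac19\epsilon_H$$ (the last two whenever a Hessian is requested). Let $T$ be the iteration at which the algorithm returns ($T=\infty$ if it never does). Put $\Delta=f(x_0)-\bar f$ and, for $0<\delta<1$ and an integer $\eta\ge2$, $$C_\epsilon=\min\Big(\frac{\epsilon_g^2}{6L},\frac{2\epsilon_H^3}{9M^2}\Big),\quad B=1+\frac{18\alpha L}{M\epsilon_g},\quad C=2304\,\frac{M^2\alpha^2\epsilon_g^2}{\epsilon_H^6},$$ $$K=\max\Big\{C\log\tfrac1\delta,\ 4\eta C\Big(\frac{\Delta}{C_\epsilon}\Big)^{1/\eta},\ 4\eta^2C^{1+\frac1{\eta-1}}B^{\frac1{\eta-1}}\Big\},\qquad n=\frac{2\Delta}{C_\epsilon}+BK .$$ **Claim.** Let $\epsilon>0$, $\epsilon_g=\epsilon$, $\epsilon_H=\sqrt{\epsilon M}$, $\alpha=\epsilon_H$, $\alpha_k=\epsilon_H$ for all $k$, and $\eta=2$. 1. There is a constant $c>0$ depending only on $L$ and $M$ such that for all $\epsilon\in(0,1]$,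 all $\delta\in(0,1)$ and all values $\Delta\ge0$, $$C\le c,\qquad B\le c\,\epsilon^{-1/2},\qquad K\le c\,\big(1+\Delta+\log\tfrac1\delta\big)\,\epsilon^{-1},\qquad n\le c\,\big(1+\Delta+\log\tfrac1\delta\big)\,\epsilon^{-2}.$$ That is, $C=O(1)$, $B=O(\epsilon^{-1/2})$, $K=\tilde O(\epsilon^{-1})$ and $n=\tilde O(\epsilon^{-2})$. 2. For all $\epsilon>0$ and $\delta\in(0,1)$, the algorithm returns at some iteration $T<n$ with probability at least $1-\delta$. Moreover, if $\sqrt{\epsilon M}\le L$, this choice meets the requirements $\alpha\in[\epsilon_H,L]$ and, at every negative-curvature step, $\alpha_k\in[\epsilon_H,\min(\alpha,|\hat\lambda_k|)]$. -/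

import Mathlib

open MeasureTheory ProbabilityTheory
open scoped RealInnerProductSpace

namespace RandNC

/-- The space `ℝ^d` with the Euclidean norm. -/
abbrev Vec (d : ℕ) : Type := EuclideanSpace ℝ (Fin d)

/-- Linear operators on `ℝ^d` (that is, `d × d` matrices), with the spectral norm. -/
abbrev Op (d : ℕ) : Type := Vec d →L[ℝ] Vec d

/-- The Hessian of `f` at `x`, as the derivative of the gradient. -/
noncomputable def hessian {d : ℕ} (f : Vec d → ℝ) (x : Vec d) : Op d :=
  fderiv ℝ (gradient f) x

/-- The minimum eigenvalue of a symmetric operator. -/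
noncomputable def lambdaMin {d : ℕ} (A : Op d) : ℝ :=
  sInf {μ : ℝ | Module.End.HasEigenvalue (A : Vec d →ₗ[ℝ] Vec d) μ}

/-- `f` is twice continuously differentiable, its gradient is `L`-Lipschitz, its Hessian is
`M`-Lipschitz (for the spectral norm), and `f` is bounded below by `fbar`. -/
structure IsObjective {d : ℕ} (f : Vec d → ℝ) (L M fbar : ℝ) : Prop where
  contDiff : ContDiff ℝ 2 f
  gradient_lipschitz : ∀ x y, ‖gradient f x - gradient f y‖ ≤ L * ‖x - y‖
  hessian_lipschitz : ∀ x y, ‖hessian f x - hessian f y‖ ≤ M * ‖x - y‖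
  lower_bound : ∀ x, fbar ≤ f x

/-- The scalar inputs of the algorithm: the tolerances `ε_g`, `ε_H`, the Lipschitz constants
`L`, `M`, and the upper bound `α` on the negative curvature step sizes. -/
structure Params where
  epsG : ℝ
  epsH : ℝ
  L : ℝ
  M : ℝ
  alpha : ℝ

/-- Everything that the algorithm receives or draws along a run on the sample space `Ω`:
approximate gradients `g k`, approximate Hessians `H k`, approximate minimal eigenvectors
`p k`, step sizes `stepSize k` and random signs `sign k`. -/
structure RunData (d : ℕ) (Ω : Type*) where
  g : ℕ → Ω → Vec d
  H : ℕ → Ω → Op d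
  p : ℕ → Ω → Vec d
  stepSize : ℕ → Ω → ℝ
  sign : ℕ → Ω → ℝ

section Algorithm

variable {d : ℕ} {Ω : Type*}

/-- The approximate minimum eigenvalue `p_kᵀ H_k p_k`. -/
noncomputable def lambdaHat (R : RunData d Ω) (k : ℕ) (ω : Ω) : ℝ :=
  ⟪R.p k ω, R.H k ω (R.p k ω)⟫

/-- Condition for a gradient step at iteration `k`. -/
def GradStep (π : Params) (R : RunData d Ω) (k : ℕ) (ω : Ω) : Prop :=
  π.epsG < ‖R.g k ω‖

/-- Condition for a negative curvature step at iteration `k`. -/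
def NegCurvStep (π : Params) (R : RunData d Ω) (k : ℕ) (ω : Ω) : Prop :=
  ¬ GradStep π R k ω ∧ lambdaHat R k ω < -π.epsH

/-- Condition for returning `x_k` at iteration `k`. -/
def Returns (π : Params) (R : RunData d Ω) (k : ℕ) (ω : Ω) : Prop :=
  ¬ GradStep π R k ω ∧ ¬ NegCurvStep π R k ω

open Classical in
/-- The iterates `x_k` of the algorithm started at `x0`. Values after the first index at which
the algorithm returns are irrelevant. -/
noncomputable def iterate (π : Params) (R : RunData d Ω) (x0 : Vec d) : ℕ → Ω → Vec d
  | 0, _ => x0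
  | k + 1, ω =>
    if GradStep π R k ω then
      iterate π R x0 k ω - (1 / π.L) • R.g k ω
    else if NegCurvStep π R k ω then
      iterate π R x0 k ω + (2 * R.stepSize k ω / π.M * R.sign k ω) • R.p k ω
    else
      iterate π R x0 k ω

/-- The iteration at which the algorithm returns (`⊤` if it never does). -/
noncomputable def stopTime (π : Params) (R : RunData d Ω) (ω : Ω) : ℕ∞ :=
  ⨅ (k : ℕ) (_ : Returns π R k ω), (k : ℕ∞)

/-- Step sizes allowed by the algorithm: `α ∈ [ε_H, L]`, and `α_k ∈ [ε_H, min(α, |λ̂_k|)]` at every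
negative curvature step. -/
def AdmissibleSteps (π : Params) (R : RunData d Ω) : Prop :=
  π.alpha ∈ Set.Icc π.epsH π.L ∧
  ∀ k ω, NegCurvStep π R k ω →
    R.stepSize k ω ∈ Set.Icc π.epsH (min π.alpha |lambdaHat R k ω|)

/-- The information structure of a run: what is supplied at iteration `k` is known at time `k`
(it may depend on the past, and may be random), and `sign k` is a fair `±1` coin, independent of
the information at time `k`, that is known at time `k + 1`. -/
structure IsRandomized [mΩ : MeasurableSpace Ω] (P : Measure Ω) (ℱ : Filtration ℕ mΩ)
    (R : RunData d Ω) : Prop where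
  g_meas : ∀ k, StronglyMeasurable[ℱ k] (R.g k)
  H_meas : ∀ k, StronglyMeasurable[ℱ k] (R.H k)
  p_meas : ∀ k, StronglyMeasurable[ℱ k] (R.p k)
  stepSize_meas : ∀ k, StronglyMeasurable[ℱ k] (R.stepSize k)
  sign_meas : ∀ k, StronglyMeasurable[ℱ (k + 1)] (R.sign k)
  sign_one : ∀ k, P {ω | R.sign k ω = 1} = 1 / 2
  sign_neg_one : ∀ k, P {ω | R.sign k ω = -1} = 1 / 2
  sign_indep : ∀ k, Indep (MeasurableSpace.comap (R.sign k) inferInstance) (ℱ k) P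

/-- Accuracy of the gradients at all iterations `k` up to termination:
`‖g_k - ∇f(x_k)‖ ≤ (1/3) max(ε_g, ‖g_k‖)`. -/
def AccurateGradients (π : Params) (R : RunData d Ω) (f : Vec d → ℝ) (x0 : Vec d) (ω : Ω) :
    Prop :=
  ∀ k : ℕ, (k : ℕ∞) ≤ stopTime π R ω →
    ‖R.g k ω - gradient f (iterate π R x0 k ω)‖ ≤ 1 / 3 * max π.epsG ‖R.g k ω‖

/-- Accuracy of the (symmetric) approximate Hessians, `‖H_k - ∇²f(x_k)‖ ≤ (2/9) ε_H`, at all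
iterations up to termination at which a Hessian is requested. -/
def AccurateHessians (π : Params) (R : RunData d Ω) (f : Vec d → ℝ) (x0 : Vec d) (ω : Ω) :
    Prop :=
  ∀ k : ℕ, (k : ℕ∞) ≤ stopTime π R ω → ¬ GradStep π R k ω →
    (R.H k ω : Vec d →ₗ[ℝ] Vec d).IsSymmetric ∧
    ‖R.H k ω - hessian f (iterate π R x0 k ω)‖ ≤ 2 / 9 * π.epsH

/-- Accuracy of the approximate minimal eigenpairs, `‖p_k‖ = 1` and
`|λ̂_k - λ_min(H_k)| ≤ (1/9) ε_H`, at all iterations up to termination at which a Hessian is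
requested. -/
def AccurateEigenpairs (π : Params) (R : RunData d Ω) (ω : Ω) : Prop :=
  ∀ k : ℕ, (k : ℕ∞) ≤ stopTime π R ω → ¬ GradStep π R k ω →
    ‖R.p k ω‖ = 1 ∧ |lambdaHat R k ω - lambdaMin (R.H k ω)| ≤ 1 / 9 * π.epsH

end Algorithm

/-- `C_ε = min(ε_g² / (6L), 2 ε_H³ / (9 M²))`. -/
noncomputable def constCeps (π : Params) : ℝ :=
  min (π.epsG ^ 2 / (6 * π.L)) (2 * π.epsH ^ 3 / (9 * π.M ^ 2))

/-- `B = 1 + 18 α L / (M ε_g)`. -/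
noncomputable def constB (π : Params) : ℝ :=
  1 + 18 * π.alpha * π.L / (π.M * π.epsG)

/-- `C = 2304 M² α² ε_g² / ε_H⁶`. -/
noncomputable def constC (π : Params) : ℝ :=
  2304 * (π.M ^ 2 * π.alpha ^ 2 * π.epsG ^ 2 / π.epsH ^ 6)

/-- `K = max { C log(1/δ), 4 η C (Δ / C_ε)^(1/η), 4 η² C^(1 + 1/(η-1)) B^(1/(η-1)) }`, where `Δ`
stands for `f(x₀) - fbar`. -/
noncomputable def constK (π : Params) (η : ℕ) (Δ δ : ℝ) : ℝ :=
  max (constC π * Real.log (1 / δ))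
    (max (4 * (η : ℝ) * constC π * (Δ / constCeps π) ^ (1 / (η : ℝ)))
      (4 * (η : ℝ) ^ 2 * constC π ^ (1 + 1 / ((η : ℝ) - 1)) *
        constB π ^ (1 / ((η : ℝ) - 1))))

/-- The iteration bound `n = 2 Δ / C_ε + B K`. -/
noncomputable def iterBound (π : Params) (η : ℕ) (Δ δ : ℝ) : ℝ :=
  2 * (Δ / constCeps π) + constB π * constK π η Δ δ

/-- The parameters `ε_g = ε`, `ε_H = √(ε M)`, `α = ε_H`. -/
noncomputable def shortStepParams (L M ε : ℝ) : Params where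
  epsG := ε
  epsH := √(ε * M)
  L := L
  M := M
  alpha := √(ε * M)

end RandNC

/-!
A gradient step decreases the objective by at least `ε_g² / (6L)`. By the cubic Taylor bound, a
negative curvature step with step size `α_k` decreases it by `D_k = 2 α_k³ / (9M²)`, up to a
first-order term `σ_k b_k` with `|b_k| ≤ 8 α_k ε_g / (3M)` that the fair sign `σ_k` makes a
martingale difference.

Whatever the signs, a negative curvature step increases the objective by at most
`8 α ε_g / (3M)`, which `B - 1` gradient steps more than make up for. Hence a run of
`2Δ / C_ε + B C log(1/δ)` iterations without return contains at least `C log(1/δ)` negative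
curvature steps. The decrease accumulated by such a run, apart from the noise `∑ σ_k b_k`, exceeds
`Δ` by so much that the noise must be large. This has probability at most `δ` by Markov's
inequality for the supermartingale `exp ∑ (σ_k θ b_k - (θ b_k)² / 2)`, where
`θ = ε_H / (128 ε_g²)` makes `θ b_k² / 2` at most `D_k / 8`.
-/

namespace RandNC

section Taylor

lemma le_cubic_of_hasDerivAt_le {φ φ' : ℝ → ℝ} {a b c t : ℝ} (hφ : ∀ s, HasDerivAt φ (φ' s) s)
    (hφ' : ∀ s, 0 ≤ s → φ' s ≤ a + b * s + c * s ^ 2) (ht : 0 ≤ t) :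
    φ t ≤ φ 0 + a * t + b / 2 * t ^ 2 + c / 3 * t ^ 3 := by
  have hcubic (s : ℝ) : HasDerivAt (fun s => φ 0 + a * s + b / 2 * s ^ 2 + c / 3 * s ^ 3)
      (a + b * s + c * s ^ 2) s := by
    refine (((((hasDerivAt_id s).const_mul a).const_add (φ 0)).add
      ((hasDerivAt_pow 2 s).const_mul (b / 2))).add
      ((hasDerivAt_pow 3 s).const_mul (c / 3))).congr_deriv ?_
    simp only [mul_one, Nat.cast_ofNat, Nat.add_one_sub_one, pow_one]
    ring
  exact image_le_of_deriv_right_le_deriv_boundary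
    (fun s _ => (hφ s).continuousAt.continuousWithinAt) (fun s _ => (hφ s).hasDerivWithinAt)
    (by simp) (fun s _ => (hcubic s).continuousAt.continuousWithinAt)
    (fun s _ => (hcubic s).hasDerivWithinAt) (fun s hs => hφ' s hs.1) (Set.right_mem_Icc.2 ht)

variable {E : Type*} [NormedAddCommGroup E] [InnerProductSpace ℝ E]

lemma hasDerivAt_add_smul (x s : E) (t : ℝ) : HasDerivAt (fun t : ℝ => x + t • s) s t := by
  simpa using ((hasDerivAt_id t).smul_const s).const_add x

lemma hasDerivAt_inner_along_line {f' : E → E} {f'' : E → E →L[ℝ] E}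
    (hf' : ∀ x, HasFDerivAt f' (f'' x) x) (x s : E) (t : ℝ) :
    HasDerivAt (fun t : ℝ => ⟪f' (x + t • s), s⟫) ⟪f'' (x + t • s) s, s⟫ t := by
  simpa using ((hf' _).comp_hasDerivAt t (hasDerivAt_add_smul x s t)).inner ℝ
    (hasDerivAt_const t s)

lemma inner_le_linear_of_lipschitz_hessian {f' : E → E} {f'' : E → E →L[ℝ] E} {M t : ℝ} {x : E}
    (hf' : ∀ y, HasFDerivAt f' (f'' y) y) (hM : ∀ y, ‖f'' y - f'' x‖ ≤ M * ‖y - x‖) (s : E)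
    (ht : 0 ≤ t) :
    ⟪f' (x + t • s), s⟫ ≤ ⟪f' x, s⟫ + ⟪f'' x s, s⟫ * t + M / 2 * ‖s‖ ^ 3 * t ^ 2 := by
  have hcurv (t : ℝ) (ht : 0 ≤ t) :
      ⟪f'' (x + t • s) s, s⟫ ≤ ⟪f'' x s, s⟫ + M * ‖s‖ ^ 3 * t + 0 * t ^ 2 := by
    have hlip := hM (x + t • s)
    rw [add_sub_cancel_left, norm_smul, Real.norm_of_nonneg ht] at hlip
    calc ⟪f'' (x + t • s) s, s⟫
        = ⟪f'' x s, s⟫ + ⟪(f'' (x + t • s) - f'' x) s, s⟫ := by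
          rw [_root_.sub_apply, inner_sub_left]; ring
      _ ≤ ⟪f'' x s, s⟫ + M * (t * ‖s‖) * ‖s‖ * ‖s‖ := by
          gcongr
          refine (real_inner_le_norm _ _).trans ?_
          gcongr
          exact (f'' (x + t • s) - f'' x).le_of_opNorm_le hlip s
      _ = _ := by ring
  have key := le_cubic_of_hasDerivAt_le (hasDerivAt_inner_along_line hf' x s) hcurv ht
  simp only [zero_smul, add_zero, zero_div, zero_mul] at key
  linarith

variable [CompleteSpace E] {f : E → ℝ} {f' : E → E} {x : E}

lemma hasDerivAt_along_line (hf : ∀ y, HasGradientAt f (f' y) y) (x s : E) (t : ℝ) :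
    HasDerivAt (fun t : ℝ => f (x + t • s)) ⟪f' (x + t • s), s⟫ t := by
  have hfx := (hf (x + t • s)).hasFDerivAt
  exact hfx.comp_hasDerivAt t (hasDerivAt_add_smul x s t)

lemma le_quadratic_of_lipschitz_gradient {L : ℝ} (hf : ∀ y, HasGradientAt f (f' y) y)
    (hL : ∀ y, ‖f' y - f' x‖ ≤ L * ‖y - x‖) (s : E) :
    f (x + s) ≤ f x + ⟪f' x, s⟫ + L / 2 * ‖s‖ ^ 2 := by
  have hslope (t : ℝ) (ht : 0 ≤ t) :
      ⟪f' (x + t • s), s⟫ ≤ ⟪f' x, s⟫ + L * ‖s‖ ^ 2 * t + 0 * t ^ 2 := by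
    have hlip := hL (x + t • s)
    rw [add_sub_cancel_left, norm_smul, Real.norm_of_nonneg ht] at hlip
    calc ⟪f' (x + t • s), s⟫ = ⟪f' x, s⟫ + ⟪f' (x + t • s) - f' x, s⟫ := by
          rw [inner_sub_left]; ring
      _ ≤ ⟪f' x, s⟫ + L * (t * ‖s‖) * ‖s‖ := by
          gcongr
          exact (real_inner_le_norm _ _).trans (by gcongr)
      _ = _ := by ring
  have key := le_cubic_of_hasDerivAt_le (hasDerivAt_along_line hf x s) hslope zero_le_one
  simp only [zero_smul, add_zero, one_smul, mul_one, one_pow, zero_div] at key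
  linarith

lemma le_cubic_of_lipschitz_hessian {f'' : E → E →L[ℝ] E} {M : ℝ}
    (hf : ∀ y, HasGradientAt f (f' y) y) (hf' : ∀ y, HasFDerivAt f' (f'' y) y)
    (hM : ∀ y, ‖f'' y - f'' x‖ ≤ M * ‖y - x‖) (s : E) :
    f (x + s) ≤ f x + ⟪f' x, s⟫ + 1 / 2 * ⟪f'' x s, s⟫ + M / 6 * ‖s‖ ^ 3 := by
  have key := le_cubic_of_hasDerivAt_le (hasDerivAt_along_line hf x s)
    (fun t ht => inner_le_linear_of_lipschitz_hessian hf' hM s ht) zero_le_one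
  simp only [zero_smul, add_zero, one_smul, mul_one, one_pow] at key
  linarith

end Taylor

section Steps

variable {E : Type*} [NormedAddCommGroup E] [InnerProductSpace ℝ E]

lemma abs_inner_le_of_inexact {u g p : E} {e : ℝ} (hp : ‖p‖ = 1) (hg : ‖g‖ ≤ e)
    (hacc : ‖g - u‖ ≤ 1 / 3 * max e ‖g‖) : |⟪u, p⟫| ≤ 4 / 3 * e := by
  rw [max_eq_left hg] at hacc
  calc |⟪u, p⟫| ≤ ‖u‖ * ‖p‖ := abs_real_inner_le_norm u p
    _ = ‖u‖ := by rw [hp, mul_one]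
    _ ≤ ‖g‖ + ‖g - u‖ := norm_le_norm_add_norm_sub g u
    _ ≤ 4 / 3 * e := by linarith

lemma inner_apply_le_of_norm_sub_le {A B : E →L[ℝ] E} {p : E} {e : ℝ} (hp : ‖p‖ = 1)
    (hAB : ‖A - B‖ ≤ e) : ⟪B p, p⟫ ≤ ⟪p, A p⟫ + e := by
  have hdiff : -⟪p, (A - B) p⟫ ≤ e :=
    calc -⟪p, (A - B) p⟫ ≤ ‖p‖ * ‖(A - B) p‖ :=
          (neg_le_abs _).trans (abs_real_inner_le_norm p ((A - B) p))
      _ ≤ ‖p‖ * (e * ‖p‖) := by gcongr; exact (A - B).le_of_opNorm_le hAB p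
      _ = e := by rw [hp, one_mul, mul_one]
  rw [_root_.sub_apply, inner_sub_right, real_inner_comm (B p) p] at hdiff
  linarith

variable [CompleteSpace E] {f : E → ℝ} {f' : E → E} {x : E}

lemma apply_sub_smul_le_of_inexact_gradient {L e : ℝ} {g : E} (hL : 0 < L)
    (hf : ∀ y, HasGradientAt f (f' y) y) (hlip : ∀ y, ‖f' y - f' x‖ ≤ L * ‖y - x‖)
    (he : 0 ≤ e) (hg : e < ‖g‖) (hacc : ‖g - f' x‖ ≤ 1 / 3 * max e ‖g‖) :
    f (x - (1 / L) • g) ≤ f x - e ^ 2 / (6 * L) := by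
  rw [max_eq_right hg.le] at hacc
  have hinner : 2 / 3 * ‖g‖ ^ 2 ≤ ⟪f' x, g⟫ := by
    have hdiff : ⟪g - f' x, g⟫ ≤ 1 / 3 * ‖g‖ * ‖g‖ :=
      (real_inner_le_norm _ _).trans (by gcongr)
    rw [inner_sub_left, real_inner_self_eq_norm_sq] at hdiff
    linarith
  have hquad := le_quadratic_of_lipschitz_gradient hf hlip (-((1 / L) • g))
  rw [← sub_eq_add_neg, inner_neg_right, norm_neg, norm_smul, real_inner_smul_right,
    Real.norm_of_nonneg (by positivity)] at hquad
  calc f (x - (1 / L) • g)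
      ≤ f x - 1 / L * ⟪f' x, g⟫ + L / 2 * (1 / L * ‖g‖) ^ 2 := by linarith
    _ ≤ f x - 1 / L * (2 / 3 * ‖g‖ ^ 2) + L / 2 * (1 / L * ‖g‖) ^ 2 := by gcongr
    _ = f x - ‖g‖ ^ 2 / (6 * L) := by field_simp; ring
    _ ≤ f x - e ^ 2 / (6 * L) := by gcongr

lemma apply_add_smul_le_of_inexact_hessian {f'' : E → E →L[ℝ] E} {A : E →L[ℝ] E} {M h σ : ℝ}
    {p : E} (hM : 0 < M) (hf : ∀ y, HasGradientAt f (f' y) y)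
    (hf' : ∀ y, HasFDerivAt f' (f'' y) y) (hlip : ∀ y, ‖f'' y - f'' x‖ ≤ M * ‖y - x‖)
    (hh : 0 ≤ h) (hp : ‖p‖ = 1) (hσ : |σ| = 1) (hcurv : ⟪p, A p⟫ ≤ -h)
    (hacc : ‖A - f'' x‖ ≤ 2 / 9 * h) :
    f (x + (2 * h / M * σ) • p) ≤
      f x - 2 * h ^ 3 / (9 * M ^ 2) + σ * (2 * h / M * ⟪f' x, p⟫) := by
  have hnorm : ‖(2 * h / M * σ) • p‖ = 2 * h / M := by
    rw [norm_smul, hp, Real.norm_eq_abs, abs_mul, hσ, abs_of_nonneg (by positivity), mul_one,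
      mul_one]
  have hcurv' : ⟪f'' x p, p⟫ ≤ -(7 / 9) * h := by
    linarith [inner_apply_le_of_norm_sub_le hp hacc]
  have hcubic := le_cubic_of_lipschitz_hessian hf hf' hlip ((2 * h / M * σ) • p)
  rw [hnorm, map_smul, real_inner_smul_left, real_inner_smul_right, real_inner_smul_right]
    at hcubic
  calc f (x + (2 * h / M * σ) • p)
      ≤ f x + 2 * h / M * σ * ⟪f' x, p⟫ + 1 / 2 * ((2 * h / M) ^ 2 * σ ^ 2 * ⟪f'' x p, p⟫) +
          M / 6 * (2 * h / M) ^ 3 := by linarith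
    _ ≤ f x + 2 * h / M * σ * ⟪f' x, p⟫ + 1 / 2 * ((2 * h / M) ^ 2 * 1 * (-(7 / 9) * h)) +
          M / 6 * (2 * h / M) ^ 3 := by
        rw [← sq_abs σ, hσ, one_pow]; gcongr
    _ = f x - 2 * h ^ 3 / (9 * M ^ 2) + σ * (2 * h / M * ⟪f' x, p⟫) := by
        field_simp; ring

end Steps

section Probability

variable {Ω : Type*} {m mΩ : MeasurableSpace Ω} {P : Measure Ω}

lemma ae_eq_one_or_eq_neg_one [IsProbabilityMeasure P] {s : Ω → ℝ} (hs : Measurable s)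
    (h1 : P {ω | s ω = 1} = 1 / 2) (h2 : P {ω | s ω = -1} = 1 / 2) :
    ∀ᵐ ω ∂P, s ω = 1 ∨ s ω = -1 := by
  have hmeas (c : ℝ) : MeasurableSet {ω | s ω = c} := hs (measurableSet_singleton c)
  have hdisj : Disjoint {ω | s ω = 1} {ω | s ω = -1} := by
    refine Set.disjoint_left.2 fun ω (h : s ω = 1) (h' : s ω = -1) => ?_
    linarith
  have hunion : P ({ω | s ω = 1} ∪ {ω | s ω = -1}) = 1 := by
    rw [measure_union hdisj (hmeas _), h1, h2, ENNReal.add_halves]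
  exact (prob_compl_eq_zero_iff ((hmeas 1).union (hmeas (-1)))).2 hunion

lemma hasSubgaussianMGF_of_fair_sign [IsProbabilityMeasure P] {s : Ω → ℝ} (hs : Measurable s)
    (h1 : P {ω | s ω = 1} = 1 / 2) (h2 : P {ω | s ω = -1} = 1 / 2) :
    HasSubgaussianMGF s 1 P := by
  have hmeas (c : ℝ) : MeasurableSet {ω | s ω = c} := hs (measurableSet_singleton c)
  have hae := ae_eq_one_or_eq_neg_one hs h1 h2
  have hmem : ∀ᵐ ω ∂P, s ω ∈ Set.Icc (-1 : ℝ) 1 := by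
    filter_upwards [hae] with ω hω
    rcases hω with hω | hω <;> norm_num [hω]
  have hmean : ∫ ω, s ω ∂P = 0 := by
    have hsplit : s =ᵐ[P]
        fun ω => {ω | s ω = 1}.indicator 1 ω - {ω | s ω = -1}.indicator 1 ω := by
      filter_upwards [hae] with ω hω
      rcases hω with hω | hω <;> norm_num [Set.indicator, hω]
    rw [integral_congr_ae hsplit, integral_sub
      ((integrable_const 1).indicator (hmeas 1)) ((integrable_const 1).indicator (hmeas (-1))),
      integral_indicator_one (hmeas 1), integral_indicator_one (hmeas (-1)), measureReal_def,
      measureReal_def, h1, h2, sub_self]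
  convert hasSubgaussianMGF_of_mem_Icc_of_integral_eq_zero hs.aemeasurable hmem hmean
  ext
  norm_num

lemma lintegral_exp_const_add_mul_sub_le {s : Ω → ℝ} {c : NNReal}
    (hsub : HasSubgaussianMGF s c P) (a b : ℝ) :
    ∫⁻ ω, ENNReal.ofReal (Real.exp (a + (s ω * b - c * b ^ 2 / 2))) ∂P ≤
      ENNReal.ofReal (Real.exp a) := by
  have hfactor (ω : Ω) : Real.exp (a + (s ω * b - c * b ^ 2 / 2)) =
      Real.exp (a - c * b ^ 2 / 2) * Real.exp (b * s ω) := by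
    rw [← Real.exp_add]; ring_nf
  simp only [hfactor]
  rw [← ofReal_integral_eq_lintegral_ofReal ((hsub.integrable_exp_mul b).const_mul _)
    (.of_forall fun ω => by positivity), integral_const_mul]
  refine ENNReal.ofReal_le_ofReal ?_
  calc Real.exp (a - c * b ^ 2 / 2) * mgf s P b
      ≤ Real.exp (a - c * b ^ 2 / 2) * Real.exp (c * b ^ 2 / 2) := by
        gcongr; exact hsub.mgf_le b
    _ = Real.exp a := by rw [← Real.exp_add, sub_add_cancel]

lemma lintegral_exp_add_mul_sub_le [IsFiniteMeasure P] {s x y : Ω → ℝ} {c : NNReal} (hm : m ≤ mΩ)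
    (hs : Measurable s) (hsub : HasSubgaussianMGF s c P)
    (hindep : Indep (MeasurableSpace.comap s inferInstance) m P)
    (hx : Measurable[m] x) (hy : Measurable[m] y) :
    ∫⁻ ω, ENNReal.ofReal (Real.exp (x ω + (s ω * y ω - c * y ω ^ 2 / 2))) ∂P ≤
      ∫⁻ ω, ENNReal.ofReal (Real.exp (x ω)) ∂P := by
  have hxy : Measurable[m] fun ω => (x ω, y ω) := hx.prodMk hy
  have hlaw : P.map (fun ω => (s ω, x ω, y ω)) =
      (P.map s).prod (P.map fun ω => (x ω, y ω)) :=
    (indepFun_iff_map_prod_eq_prod_map_map hs.aemeasurable (hxy.mono hm le_rfl).aemeasurable).1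
      (indep_of_indep_of_le_right hindep hxy.comap_le)
  have hF : Measurable fun v : ℝ × ℝ × ℝ =>
      ENNReal.ofReal (Real.exp (v.2.1 + (v.1 * v.2.2 - c * v.2.2 ^ 2 / 2))) := by fun_prop
  have hx' : Measurable x := hx.mono hm le_rfl
  have hy' : Measurable y := hy.mono hm le_rfl
  calc ∫⁻ ω, ENNReal.ofReal (Real.exp (x ω + (s ω * y ω - c * y ω ^ 2 / 2))) ∂P
      = ∫⁻ ω, ∫⁻ ω', ENNReal.ofReal
          (Real.exp (x ω + (s ω' * y ω - c * y ω ^ 2 / 2))) ∂P ∂P := by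
        rw [← lintegral_map hF (hs.prodMk (hx'.prodMk hy')), hlaw, lintegral_prod_symm' _ hF,
          lintegral_map hF.lintegral_prod_left' (hx'.prodMk hy')]
        exact lintegral_congr fun ω => lintegral_map (by fun_prop) hs
    _ ≤ ∫⁻ ω, ENNReal.ofReal (Real.exp (x ω)) ∂P :=
        lintegral_mono fun ω => lintegral_exp_const_add_mul_sub_le hsub (x ω) (y ω)

variable {ℱ : Filtration ℕ mΩ} {s u : ℕ → Ω → ℝ} {c : NNReal}

lemma measurable_sum_mul_sub_sq (hs : ∀ k, StronglyMeasurable[ℱ (k + 1)] (s k))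
    (hu : ∀ k, Measurable[ℱ k] (u k)) (n : ℕ) :
    Measurable[ℱ n]
      fun ω => ∑ k ∈ Finset.range n, (s k ω * u k ω - c * u k ω ^ 2 / 2) := by
  refine Finset.measurable_fun_sum _ fun k hk => ?_
  have hkn := Finset.mem_range.1 hk
  have hsk := (hs k).measurable.mono (ℱ.mono (Nat.succ_le_of_lt hkn)) le_rfl
  have huk := (hu k).mono (ℱ.mono hkn.le) le_rfl
  exact (hsk.mul huk).sub (((huk.pow_const 2).const_mul _).div_const 2)

lemma lintegral_exp_sum_mul_sub_sq_le_one [IsProbabilityMeasure P]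
    (hs : ∀ k, StronglyMeasurable[ℱ (k + 1)] (s k)) (hsub : ∀ k, HasSubgaussianMGF (s k) c P)
    (hindep : ∀ k, Indep (MeasurableSpace.comap (s k) inferInstance) (ℱ k) P)
    (hu : ∀ k, Measurable[ℱ k] (u k)) (n : ℕ) :
    ∫⁻ ω, ENNReal.ofReal (Real.exp
      (∑ k ∈ Finset.range n, (s k ω * u k ω - c * u k ω ^ 2 / 2))) ∂P ≤ 1 := by
  induction n with
  | zero => simp
  | succ n ih =>
    simp only [Finset.sum_range_succ]
    exact (lintegral_exp_add_mul_sub_le (ℱ.le n) ((hs n).measurable.mono (ℱ.le _) le_rfl)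
      (hsub n) (hindep n) (measurable_sum_mul_sub_sq hs hu n) (hu n)).trans ih

lemma measureReal_le_sum_mul_sub_sq_le_exp_neg [IsProbabilityMeasure P]
    (hs : ∀ k, StronglyMeasurable[ℱ (k + 1)] (s k)) (hsub : ∀ k, HasSubgaussianMGF (s k) c P)
    (hindep : ∀ k, Indep (MeasurableSpace.comap (s k) inferInstance) (ℱ k) P)
    (hu : ∀ k, Measurable[ℱ k] (u k)) (n : ℕ) (t : ℝ) :
    P.real {ω | t ≤ ∑ k ∈ Finset.range n, (s k ω * u k ω - c * u k ω ^ 2 / 2)} ≤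
      Real.exp (-t) := by
  have hmeas := (measurable_sum_mul_sub_sq (c := c) hs hu n).mono (ℱ.le n) le_rfl
  refine ENNReal.toReal_le_of_le_ofReal (Real.exp_nonneg _) ?_
  calc P {ω | t ≤ ∑ k ∈ Finset.range n, (s k ω * u k ω - c * u k ω ^ 2 / 2)}
      ≤ P {ω | ENNReal.ofReal (Real.exp t) ≤ ENNReal.ofReal (Real.exp
          (∑ k ∈ Finset.range n, (s k ω * u k ω - c * u k ω ^ 2 / 2)))} :=
        measure_mono fun ω hω => ENNReal.ofReal_le_ofReal (Real.exp_le_exp.2 hω)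
    _ ≤ (∫⁻ ω, ENNReal.ofReal (Real.exp
          (∑ k ∈ Finset.range n, (s k ω * u k ω - c * u k ω ^ 2 / 2))) ∂P) /
            ENNReal.ofReal (Real.exp t) :=
        meas_ge_le_lintegral_div hmeas.exp.ennreal_ofReal.aemeasurable
          (ENNReal.ofReal_pos.2 (Real.exp_pos t)).ne' ENNReal.ofReal_ne_top
    _ ≤ 1 / ENNReal.ofReal (Real.exp t) := by
        gcongr
        exact lintegral_exp_sum_mul_sub_sq_le_one hs hsub hindep hu n
    _ = ENNReal.ofReal (Real.exp (-t)) := by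
        rw [Real.exp_neg, ENNReal.ofReal_inv_of_pos (Real.exp_pos t), one_div]

end Probability

section Run

variable {d : ℕ} {Ω : Type*} {f : Vec d → ℝ} {L M fbar : ℝ} {π : Params} {R : RunData d Ω}
  {x0 : Vec d} {ω : Ω} {k n : ℕ}

lemma IsObjective.hasGradientAt (hf : IsObjective f L M fbar) (x : Vec d) :
    HasGradientAt f (gradient f x) x :=
  (hf.contDiff.differentiable two_ne_zero x).hasGradientAt

lemma IsObjective.hasFDerivAt_gradient (hf : IsObjective f L M fbar) (x : Vec d) :
    HasFDerivAt (gradient f) (hessian f x) x := by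
  have hfderiv : ContDiff ℝ 1 (fderiv ℝ f) := hf.contDiff.fderiv_right (by norm_num)
  have hgrad : Differentiable ℝ (gradient f) :=
    (InnerProductSpace.toDual ℝ (Vec d)).symm.toContinuousLinearEquiv.differentiable.comp
      (hfderiv.differentiable one_ne_zero)
  exact (hgrad x).hasFDerivAt

lemma IsObjective.continuous_gradient (hf : IsObjective f L M fbar) : Continuous (gradient f) :=
  continuous_iff_continuousAt.2 fun x => (hf.hasFDerivAt_gradient x).continuousAt

lemma exists_stopTime_eq_of_returns (h : Returns π R n ω) :
    ∃ k : ℕ, stopTime π R ω = k ∧ k ≤ n := by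
  have hle : stopTime π R ω ≤ (n : ℕ∞) := iInf₂_le n h
  obtain ⟨k, hk⟩ := ENat.ne_top_iff_exists.1 (ne_top_of_le_ne_top (ENat.natCast_ne_top n) hle)
  exact ⟨k, hk.symm, Nat.cast_le.1 (hk.trans_le hle)⟩

lemma le_stopTime (h : ∀ j < n, ¬ Returns π R j ω) : (n : ℕ∞) ≤ stopTime π R ω :=
  le_iInf₂ fun k hk => Nat.cast_le.2 (not_lt.1 fun hkn => h k hkn hk)

lemma gradStep_of_not_returns (h : ¬ Returns π R k ω) (hN : ¬ NegCurvStep π R k ω) :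
    GradStep π R k ω :=
  not_not.1 fun hG => h ⟨hG, hN⟩

lemma iterate_succ_of_gradStep (h : GradStep π R k ω) :
    iterate π R x0 (k + 1) ω = iterate π R x0 k ω - (1 / π.L) • R.g k ω := by
  rw [iterate, if_pos h]

lemma iterate_succ_of_negCurvStep (h : NegCurvStep π R k ω) :
    iterate π R x0 (k + 1) ω =
      iterate π R x0 k ω + (2 * R.stepSize k ω / π.M * R.sign k ω) • R.p k ω := by
  rw [iterate, if_neg h.1, if_pos h]

open Classical in
/-- The change of the objective to first order along `2 α_k / M • p_k` at a negative curvature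
step, and `0` at all other iterations. It is the coefficient of the random sign in the change of
the objective. -/
noncomputable def curvSlope (π : Params) (R : RunData d Ω) (f : Vec d → ℝ) (x0 : Vec d) (k : ℕ)
    (ω : Ω) : ℝ :=
  if NegCurvStep π R k ω then
    2 * R.stepSize k ω / π.M * ⟪gradient f (iterate π R x0 k ω), R.p k ω⟫
  else 0

section Measurability

variable [mΩ : MeasurableSpace Ω] {P : Measure Ω} {ℱ : Filtration ℕ mΩ}

lemma IsRandomized.ae_sign [IsProbabilityMeasure P] (hR : IsRandomized P ℱ R) :
    ∀ᵐ ω ∂P, ∀ k, R.sign k ω = 1 ∨ R.sign k ω = -1 :=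
  ae_all_iff.2 fun k => ae_eq_one_or_eq_neg_one ((hR.sign_meas k).measurable.mono (ℱ.le _) le_rfl)
    (hR.sign_one k) (hR.sign_neg_one k)

lemma IsRandomized.hasSubgaussianMGF_sign [IsProbabilityMeasure P] (hR : IsRandomized P ℱ R)
    (k : ℕ) : HasSubgaussianMGF (R.sign k) 1 P :=
  hasSubgaussianMGF_of_fair_sign ((hR.sign_meas k).measurable.mono (ℱ.le _) le_rfl)
    (hR.sign_one k) (hR.sign_neg_one k)

lemma IsRandomized.measurableSet_gradStep (hR : IsRandomized P ℱ R) (π : Params) (k : ℕ) :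
    MeasurableSet[ℱ k] {ω | GradStep π R k ω} :=
  (hR.g_meas k).norm.measurable measurableSet_Ioi

lemma IsRandomized.measurableSet_negCurvStep (hR : IsRandomized P ℱ R) (π : Params) (k : ℕ) :
    MeasurableSet[ℱ k] {ω | NegCurvStep π R k ω} := by
  have hlambda : StronglyMeasurable[ℱ k] (lambdaHat R k) :=
    (hR.p_meas k).inner (isBoundedBilinearMap_apply.continuous.comp_stronglyMeasurable
      ((hR.H_meas k).prodMk (hR.p_meas k)))
  exact (hR.measurableSet_gradStep π k).compl.inter (hlambda.measurable measurableSet_Iio)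

lemma IsRandomized.stronglyMeasurable_stepLength (hR : IsRandomized P ℱ R) (c : ℝ) (k : ℕ) :
    StronglyMeasurable[ℱ k] fun ω => 2 * R.stepSize k ω / c := by
  simp only [div_eq_mul_inv]
  exact ((hR.stepSize_meas k).const_mul 2).mul_const _

lemma IsRandomized.stronglyMeasurable_iterate (hR : IsRandomized P ℱ R) (π : Params)
    (x0 : Vec d) (k : ℕ) : StronglyMeasurable[ℱ k] (iterate π R x0 k) := by
  induction k with
  | zero => exact stronglyMeasurable_const
  | succ k ih =>
    have hle := ℱ.mono k.le_succ
    have hx := ih.mono hle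
    refine .ite (hle _ (hR.measurableSet_gradStep π k))
      (hx.sub (((hR.g_meas k).mono hle).const_smul (1 / π.L)))
      (.ite (hle _ (hR.measurableSet_negCurvStep π k)) (hx.add ?_) hx)
    exact (((hR.stronglyMeasurable_stepLength π.M k).mono hle).mul (hR.sign_meas k)).smul
      ((hR.p_meas k).mono hle)

lemma IsRandomized.measurable_curvSlope (hR : IsRandomized P ℱ R)
    (hf : IsObjective f L M fbar) (π : Params) (x0 : Vec d) (k : ℕ) :
    Measurable[ℱ k] (curvSlope π R f x0 k) := by
  have hslope : StronglyMeasurable[ℱ k]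
      fun ω => ⟪gradient f (iterate π R x0 k ω), R.p k ω⟫ :=
    (hf.continuous_gradient.comp_stronglyMeasurable
      (hR.stronglyMeasurable_iterate π x0 k)).inner (hR.p_meas k)
  exact (StronglyMeasurable.ite (hR.measurableSet_negCurvStep π k)
    ((hR.stronglyMeasurable_stepLength π.M k).mul hslope) stronglyMeasurable_const).measurable

end Measurability

/-- The parameters covered by the complexity analysis. The requirement `α ≤ L` of
`AdmissibleSteps` is not part of it. -/
structure Params.Valid (π : Params) : Prop where
  epsG_pos : 0 < π.epsG
  epsH_pos : 0 < π.epsH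
  L_pos : 0 < π.L
  M_pos : 0 < π.M
  epsH_le_alpha : π.epsH ≤ π.alpha

/-- What the complexity analysis requires of the data supplied at iteration `k`: accuracy of the
gradient and, at a negative curvature step, accuracy of the Hessian, a unit direction and a step
size in `[ε_H, min(α, |λ̂_k|)]`. -/
structure AccurateStep (π : Params) (R : RunData d Ω) (f : Vec d → ℝ) (x0 : Vec d) (k : ℕ)
    (ω : Ω) : Prop where
  gradient :
    ‖R.g k ω - gradient f (iterate π R x0 k ω)‖ ≤ 1 / 3 * max π.epsG ‖R.g k ω‖
  hessian : NegCurvStep π R k ω →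
    ‖R.H k ω - hessian f (iterate π R x0 k ω)‖ ≤ 2 / 9 * π.epsH
  norm_direction : NegCurvStep π R k ω → ‖R.p k ω‖ = 1
  stepSize_mem : NegCurvStep π R k ω →
    R.stepSize k ω ∈ Set.Icc π.epsH (min π.alpha |lambdaHat R k ω|)

/-- The decrease of the objective guaranteed at a gradient step. -/
noncomputable def gradDecrease (π : Params) : ℝ := π.epsG ^ 2 / (6 * π.L)

/-- The decrease of the objective guaranteed at a negative curvature step, apart from the
first-order change `curvSlope`, whose sign is random. -/
noncomputable def curvDecrease (π : Params) : ℝ := 2 * π.epsH ^ 3 / (9 * π.M ^ 2)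

/-- The largest possible increase of the objective at a negative curvature step. -/
noncomputable def curvIncrease (π : Params) : ℝ := 8 * π.alpha * π.epsG / (3 * π.M)

lemma constCeps_le_gradDecrease (π : Params) : constCeps π ≤ gradDecrease π := min_le_left _ _

lemma constCeps_le_curvDecrease (π : Params) : constCeps π ≤ curvDecrease π := min_le_right _ _

namespace Params.Valid

lemma alpha_pos (hπ : π.Valid) : 0 < π.alpha := hπ.epsH_pos.trans_le hπ.epsH_le_alpha

lemma gradDecrease_pos (hπ : π.Valid) : 0 < gradDecrease π := by
  have := hπ.epsG_pos
  have := hπ.L_pos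
  unfold gradDecrease
  positivity

lemma curvDecrease_pos (hπ : π.Valid) : 0 < curvDecrease π := by
  have := hπ.epsH_pos
  have := hπ.M_pos
  unfold curvDecrease
  positivity

lemma curvIncrease_pos (hπ : π.Valid) : 0 < curvIncrease π := by
  have := hπ.epsG_pos
  have := hπ.alpha_pos
  have := hπ.M_pos
  unfold curvIncrease
  positivity

lemma constCeps_pos (hπ : π.Valid) : 0 < constCeps π :=
  lt_min hπ.gradDecrease_pos hπ.curvDecrease_pos

lemma one_le_constB (hπ : π.Valid) : 1 ≤ constB π := by
  have := hπ.epsG_pos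
  have := hπ.alpha_pos
  have := hπ.L_pos
  have := hπ.M_pos
  refine le_add_of_nonneg_right ?_
  positivity

lemma constC_pos (hπ : π.Valid) : 0 < constC π := by
  have := hπ.epsG_pos
  have := hπ.epsH_pos
  have := hπ.alpha_pos
  have := hπ.M_pos
  unfold constC
  positivity

end Params.Valid

/-- The parameter of the exponential supermartingale that controls the random signs. It is chosen
such that compensating the signs costs at most `1/8` of the decrease of a negative curvature
step. -/
noncomputable def tilt (π : Params) : ℝ := π.epsH / (128 * π.epsG ^ 2)

lemma Params.Valid.tilt_pos (hπ : π.Valid) : 0 < tilt π := by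
  have := hπ.epsG_pos
  have := hπ.epsH_pos
  unfold tilt
  positivity

namespace AccurateStep

lemma apply_iterate_succ_le_of_gradStep (hπ : π.Valid) (hf : IsObjective f π.L π.M fbar)
    (hk : AccurateStep π R f x0 k ω) (hG : GradStep π R k ω) :
    f (iterate π R x0 (k + 1) ω) ≤ f (iterate π R x0 k ω) - gradDecrease π := by
  rw [iterate_succ_of_gradStep hG]
  exact apply_sub_smul_le_of_inexact_gradient hπ.L_pos hf.hasGradientAt
    (fun y => hf.gradient_lipschitz y _) hπ.epsG_pos.le hG hk.gradient

lemma apply_iterate_succ_le_of_negCurvStep (hπ : π.Valid) (hf : IsObjective f π.L π.M fbar)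
    (hk : AccurateStep π R f x0 k ω) (hsign : R.sign k ω = 1 ∨ R.sign k ω = -1)
    (hN : NegCurvStep π R k ω) :
    f (iterate π R x0 (k + 1) ω) ≤ f (iterate π R x0 k ω) -
      2 * R.stepSize k ω ^ 3 / (9 * π.M ^ 2) + R.sign k ω * curvSlope π R f x0 k ω := by
  obtain ⟨hlow, hup⟩ := hk.stepSize_mem hN
  have hcurv : ⟪R.p k ω, R.H k ω (R.p k ω)⟫ ≤ -R.stepSize k ω := by
    have hneg : lambdaHat R k ω < 0 := hN.2.trans (neg_lt_zero.2 hπ.epsH_pos)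
    have hle := hup.trans (min_le_right _ _)
    rw [abs_of_neg hneg] at hle
    exact le_neg.1 hle
  rw [iterate_succ_of_negCurvStep hN, curvSlope, if_pos hN]
  exact apply_add_smul_le_of_inexact_hessian hπ.M_pos hf.hasGradientAt hf.hasFDerivAt_gradient
    (fun y => hf.hessian_lipschitz y _) (hπ.epsH_pos.le.trans hlow) (hk.norm_direction hN)
    ((abs_eq zero_le_one).2 hsign) hcurv ((hk.hessian hN).trans (by gcongr))

lemma abs_curvSlope_le (hπ : π.Valid) (hk : AccurateStep π R f x0 k ω)
    (hN : NegCurvStep π R k ω) :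
    |curvSlope π R f x0 k ω| ≤ 8 * R.stepSize k ω * π.epsG / (3 * π.M) := by
  have hM := hπ.M_pos
  have hstep : 0 ≤ R.stepSize k ω := hπ.epsH_pos.le.trans (hk.stepSize_mem hN).1
  rw [curvSlope, if_pos hN, abs_mul, abs_of_nonneg (by positivity)]
  calc 2 * R.stepSize k ω / π.M * |⟪_root_.gradient f (iterate π R x0 k ω), R.p k ω⟫|
      ≤ 2 * R.stepSize k ω / π.M * (4 / 3 * π.epsG) := by
        gcongr
        exact abs_inner_le_of_inexact (hk.norm_direction hN) (not_lt.1 hN.1) hk.gradient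
    _ = 8 * R.stepSize k ω * π.epsG / (3 * π.M) := by field_simp; ring

lemma tilt_mul_curvSlope_sq_le (hπ : π.Valid) (hk : AccurateStep π R f x0 k ω)
    (hN : NegCurvStep π R k ω) :
    tilt π * curvSlope π R f x0 k ω ^ 2 ≤
      1 / 4 * (2 * R.stepSize k ω ^ 3 / (9 * π.M ^ 2)) := by
  have hG := hπ.epsG_pos
  have hM := hπ.M_pos
  have htilt := hπ.tilt_pos
  have hlow := (hk.stepSize_mem hN).1
  have hstep : 0 < R.stepSize k ω := hπ.epsH_pos.trans_le hlow
  calc tilt π * curvSlope π R f x0 k ω ^ 2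
      = tilt π * |curvSlope π R f x0 k ω| ^ 2 := by rw [sq_abs]
    _ ≤ tilt π * (8 * R.stepSize k ω * π.epsG / (3 * π.M)) ^ 2 := by
        gcongr; exact hk.abs_curvSlope_le hπ hN
    _ = 1 / 4 * (2 * (R.stepSize k ω ^ 2 * π.epsH) / (9 * π.M ^ 2)) := by
        unfold tilt; field_simp; ring
    _ ≤ 1 / 4 * (2 * (R.stepSize k ω ^ 2 * R.stepSize k ω) / (9 * π.M ^ 2)) := by gcongr
    _ = 1 / 4 * (2 * R.stepSize k ω ^ 3 / (9 * π.M ^ 2)) := by rw [← pow_succ]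

open Classical in
lemma apply_iterate_succ_sub_le (hπ : π.Valid) (hf : IsObjective f π.L π.M fbar)
    (hk : AccurateStep π R f x0 k ω) (hsign : R.sign k ω = 1 ∨ R.sign k ω = -1)
    (hret : ¬ Returns π R k ω) :
    f (iterate π R x0 (k + 1) ω) - f (iterate π R x0 k ω) ≤
      if NegCurvStep π R k ω then curvIncrease π else -gradDecrease π := by
  split_ifs with hN
  · have hM := hπ.M_pos
    have hG := hπ.epsG_pos
    obtain ⟨hlow, hup⟩ := hk.stepSize_mem hN
    have hstep : 0 < R.stepSize k ω := hπ.epsH_pos.trans_le hlow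
    have hdec : 0 ≤ 2 * R.stepSize k ω ^ 3 / (9 * π.M ^ 2) := by positivity
    have hnoise : R.sign k ω * curvSlope π R f x0 k ω ≤ curvIncrease π :=
      calc R.sign k ω * curvSlope π R f x0 k ω
          ≤ |R.sign k ω * curvSlope π R f x0 k ω| := le_abs_self _
        _ = |curvSlope π R f x0 k ω| := by
            rw [abs_mul, (abs_eq zero_le_one).2 hsign, one_mul]
        _ ≤ 8 * R.stepSize k ω * π.epsG / (3 * π.M) := hk.abs_curvSlope_le hπ hN
        _ ≤ curvIncrease π := by unfold curvIncrease; gcongr; exact hup.trans (min_le_left _ _)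
    linarith [hk.apply_iterate_succ_le_of_negCurvStep hπ hf hsign hN]
  · have hG := gradStep_of_not_returns hret hN
    linarith [hk.apply_iterate_succ_le_of_gradStep hπ hf hG]

open Classical in
lemma tilt_mul_apply_iterate_succ_sub_le (hπ : π.Valid) (hf : IsObjective f π.L π.M fbar)
    (hk : AccurateStep π R f x0 k ω) (hsign : R.sign k ω = 1 ∨ R.sign k ω = -1)
    (hret : ¬ Returns π R k ω) :
    tilt π * (f (iterate π R x0 (k + 1) ω) - f (iterate π R x0 k ω)) ≤
      tilt π * (if NegCurvStep π R k ω then -(7 / 8 * curvDecrease π) else -gradDecrease π) +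
        (R.sign k ω * (tilt π * curvSlope π R f x0 k ω) -
          (tilt π * curvSlope π R f x0 k ω) ^ 2 / 2) := by
  have htilt := hπ.tilt_pos
  split_ifs with hN
  · have hH := hπ.epsH_pos
    have hM := hπ.M_pos
    have hdec : curvDecrease π ≤ 2 * R.stepSize k ω ^ 3 / (9 * π.M ^ 2) := by
      unfold curvDecrease; gcongr; exact (hk.stepSize_mem hN).1
    have hdescent := hk.apply_iterate_succ_le_of_negCurvStep hπ hf hsign hN
    have hsq := hk.tilt_mul_curvSlope_sq_le hπ hN
    calc tilt π * (f (iterate π R x0 (k + 1) ω) - f (iterate π R x0 k ω))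
        ≤ tilt π * (-(7 / 8 * curvDecrease π) + R.sign k ω * curvSlope π R f x0 k ω -
            tilt π * curvSlope π R f x0 k ω ^ 2 / 2) :=
          mul_le_mul_of_nonneg_left (by linarith) htilt.le
      _ = _ := by ring
  · have hG := gradStep_of_not_returns hret hN
    have hzero : curvSlope π R f x0 k ω = 0 := if_neg hN
    have hdescent := hk.apply_iterate_succ_le_of_gradStep hπ hf hG
    rw [hzero, mul_zero, mul_zero, zero_pow two_ne_zero, zero_div, sub_zero, add_zero]
    gcongr
    linarith

end AccurateStep

lemma gradDecrease_add_curvIncrease_le (hπ : π.Valid) :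
    gradDecrease π + curvIncrease π ≤ gradDecrease π * constB π := by
  have hG := hπ.epsG_pos
  have hL := hπ.L_pos
  have hM := hπ.M_pos
  calc gradDecrease π + curvIncrease π
      ≤ gradDecrease π + 9 / 8 * curvIncrease π := by linarith [hπ.curvIncrease_pos]
    _ = gradDecrease π * constB π := by
        unfold gradDecrease curvIncrease constB; field_simp; ring

lemma four_le_tilt_mul_curvDecrease_mul_constC (hπ : π.Valid) :
    4 ≤ tilt π * curvDecrease π * constC π := by
  have hG := hπ.epsG_pos
  have hH := hπ.epsH_pos
  have hM := hπ.M_pos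
  calc (4 : ℝ) = 4 * (π.epsH / π.epsH) ^ 2 := by rw [div_self hH.ne', one_pow, mul_one]
    _ ≤ 4 * (π.alpha / π.epsH) ^ 2 := by gcongr; exact hπ.epsH_le_alpha
    _ = tilt π * curvDecrease π * constC π := by
        unfold tilt curvDecrease constC; field_simp; ring

lemma le_of_neg_le_curvIncrease_sub_gradDecrease {Δ m N n : ℝ} (hπ : π.Valid) (hΔ : 0 ≤ Δ)
    (hm : 0 ≤ m) (hn : 2 * (Δ / constCeps π) + constB π * m ≤ n)
    (hdec : -Δ ≤ N * curvIncrease π + (n - N) * -gradDecrease π) : m ≤ N := by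
  have ha := hπ.gradDecrease_pos
  have hw := hπ.curvIncrease_pos
  have hceps := hπ.constCeps_pos
  have hquot : Δ ≤ gradDecrease π * (Δ / constCeps π) :=
    calc Δ = constCeps π * (Δ / constCeps π) := (mul_div_cancel₀ Δ hceps.ne').symm
      _ ≤ gradDecrease π * (Δ / constCeps π) := by
          gcongr; exact constCeps_le_gradDecrease π
  have hB : (gradDecrease π + curvIncrease π) * m ≤ gradDecrease π * constB π * m :=
    mul_le_mul_of_nonneg_right (gradDecrease_add_curvIncrease_le hπ) hm
  have hbudget := mul_le_mul_of_nonneg_left hn ha.le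
  refine le_of_mul_le_mul_left ?_ (add_pos ha hw)
  linarith

lemma le_tilt_mul_of_constC_mul_le {Δ l N n : ℝ} (hπ : π.Valid) (hl : 0 ≤ l)
    (hN : constC π * l ≤ N) (hNn : N ≤ n) (hn : 2 * (Δ / constCeps π) ≤ n) :
    l ≤ tilt π * (7 / 8 * curvDecrease π * N + gradDecrease π * (n - N) - Δ) := by
  have hD := hπ.curvDecrease_pos
  have htilt := hπ.tilt_pos
  have hceps := hπ.constCeps_pos
  have hN0 : 0 ≤ N := (mul_nonneg hπ.constC_pos.le hl).trans hN
  have hNn' : 0 ≤ n - N := sub_nonneg.2 hNn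
  have hΔ : 2 * Δ ≤ curvDecrease π * N + gradDecrease π * (n - N) :=
    calc 2 * Δ = constCeps π * (2 * (Δ / constCeps π)) := by
          rw [mul_left_comm, mul_div_cancel₀ Δ hceps.ne']
      _ ≤ constCeps π * N + constCeps π * (n - N) := by
          rw [← mul_add, add_sub_cancel]; gcongr
      _ ≤ curvDecrease π * N + gradDecrease π * (n - N) := by
          gcongr
          · exact constCeps_le_curvDecrease π
          · exact constCeps_le_gradDecrease π
  have hrest : 0 ≤ gradDecrease π * (n - N) := mul_nonneg hπ.gradDecrease_pos.le hNn'
  calc l ≤ 3 / 8 * (4 * l) := by linarith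
    _ ≤ 3 / 8 * (tilt π * curvDecrease π * constC π * l) := by
        gcongr; exact four_le_tilt_mul_curvDecrease_mul_constC hπ
    _ = 3 / 8 * (tilt π * curvDecrease π * (constC π * l)) := by ring
    _ ≤ 3 / 8 * (tilt π * curvDecrease π * N) := by gcongr
    _ = tilt π * (3 / 8 * curvDecrease π * N) := by ring
    _ ≤ tilt π * (7 / 8 * curvDecrease π * N + gradDecrease π * (n - N) - Δ) :=
        mul_le_mul_of_nonneg_left (by linarith) htilt.le

open Classical in
/-- The number of negative curvature steps among the first `n` iterations. -/
noncomputable def curvCount (π : Params) (R : RunData d Ω) (n : ℕ) (ω : Ω) : ℕ :=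
  ((Finset.range n).filter fun k => NegCurvStep π R k ω).card

open Classical in
lemma curvCount_le (π : Params) (R : RunData d Ω) (n : ℕ) (ω : Ω) : curvCount π R n ω ≤ n :=
  (Finset.card_filter_le _ _).trans_eq (Finset.card_range n)

open Classical in
lemma sum_range_ite_negCurvStep (π : Params) (R : RunData d Ω) (n : ℕ) (ω : Ω) (a b : ℝ) :
    ∑ k ∈ Finset.range n, (if NegCurvStep π R k ω then a else b) =
      curvCount π R n ω * a + (n - curvCount π R n ω) * b := by
  have hcompl : (({k ∈ Finset.range n | ¬ NegCurvStep π R k ω}.card : ℕ) : ℝ) =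
      n - curvCount π R n ω := by
    rw [eq_sub_iff_add_eq', curvCount, ← Nat.cast_add, Finset.card_filter_add_card_filter_not,
      Finset.card_range]
  rw [Finset.sum_ite, Finset.sum_const, Finset.sum_const, nsmul_eq_mul, nsmul_eq_mul, hcompl,
    curvCount]

/-- The exponent after `n` iterations of the exponential supermartingale generated by the random
signs along the slopes `curvSlope`. -/
noncomputable def signExponent (π : Params) (R : RunData d Ω) (f : Vec d → ℝ) (x0 : Vec d) (n : ℕ)
    (ω : Ω) : ℝ :=
  ∑ k ∈ Finset.range n, (R.sign k ω * (tilt π * curvSlope π R f x0 k ω) -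
    (tilt π * curvSlope π R f x0 k ω) ^ 2 / 2)

lemma neg_le_curvIncrease_sub_gradDecrease (hπ : π.Valid) (hf : IsObjective f π.L π.M fbar)
    (hacc : ∀ k < n, AccurateStep π R f x0 k ω)
    (hsign : ∀ k, R.sign k ω = 1 ∨ R.sign k ω = -1) (hret : ∀ k < n, ¬ Returns π R k ω) :
    -(f x0 - fbar) ≤ curvCount π R n ω * curvIncrease π +
      (n - curvCount π R n ω) * -gradDecrease π := by
  have htotal := Finset.sum_le_sum fun k (hk : k ∈ Finset.range n) =>
    (hacc k (Finset.mem_range.1 hk)).apply_iterate_succ_sub_le hπ hf (hsign k)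
      (hret k (Finset.mem_range.1 hk))
  rw [Finset.sum_range_sub fun k => f (iterate π R x0 k ω), sum_range_ite_negCurvStep] at htotal
  have hlow := hf.lower_bound (iterate π R x0 n ω)
  rw [iterate] at htotal
  linarith

lemma tilt_mul_decrease_le_signExponent (hπ : π.Valid) (hf : IsObjective f π.L π.M fbar)
    (hacc : ∀ k < n, AccurateStep π R f x0 k ω)
    (hsign : ∀ k, R.sign k ω = 1 ∨ R.sign k ω = -1) (hret : ∀ k < n, ¬ Returns π R k ω) :
    tilt π * (7 / 8 * curvDecrease π * curvCount π R n ω +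
      gradDecrease π * (n - curvCount π R n ω) - (f x0 - fbar)) ≤
        signExponent π R f x0 n ω := by
  have htotal := Finset.sum_le_sum fun k (hk : k ∈ Finset.range n) =>
    (hacc k (Finset.mem_range.1 hk)).tilt_mul_apply_iterate_succ_sub_le hπ hf (hsign k)
      (hret k (Finset.mem_range.1 hk))
  rw [← Finset.mul_sum, Finset.sum_range_sub fun k => f (iterate π R x0 k ω),
    Finset.sum_add_distrib, ← Finset.mul_sum, sum_range_ite_negCurvStep] at htotal
  have hlow := mul_le_mul_of_nonneg_left (hf.lower_bound (iterate π R x0 n ω)) hπ.tilt_pos.le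
  rw [iterate] at htotal
  unfold signExponent
  linarith

lemma le_signExponent_of_not_returns {l : ℝ} (hπ : π.Valid) (hf : IsObjective f π.L π.M fbar)
    (hl : 0 ≤ l) (hn : 2 * ((f x0 - fbar) / constCeps π) + constB π * (constC π * l) ≤ n)
    (hacc : ∀ k < n, AccurateStep π R f x0 k ω)
    (hsign : ∀ k, R.sign k ω = 1 ∨ R.sign k ω = -1) (hret : ∀ k < n, ¬ Returns π R k ω) :
    l ≤ signExponent π R f x0 n ω := by
  have hCl : 0 ≤ constC π * l := mul_nonneg hπ.constC_pos.le hl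
  have hcount : constC π * l ≤ curvCount π R n ω :=
    le_of_neg_le_curvIncrease_sub_gradDecrease hπ (sub_nonneg.2 (hf.lower_bound x0)) hCl hn
      (neg_le_curvIncrease_sub_gradDecrease hπ hf hacc hsign hret)
  have hn' : 2 * ((f x0 - fbar) / constCeps π) ≤ n :=
    (le_add_of_nonneg_right (mul_nonneg (zero_le_one.trans hπ.one_le_constB) hCl)).trans hn
  exact (le_tilt_mul_of_constC_mul_le hπ hl hcount (Nat.cast_le.2 (curvCount_le π R n ω)) hn').trans
    (tilt_mul_decrease_le_signExponent hπ hf hacc hsign hret)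

section ReturnProbability

variable [mΩ : MeasurableSpace Ω] {P : Measure Ω} [IsProbabilityMeasure P]
  {ℱ : Filtration ℕ mΩ} {δ : ℝ}

lemma IsRandomized.measureReal_le_signExponent_le (hR : IsRandomized P ℱ R)
    (hf : IsObjective f L M fbar) (π : Params) (x0 : Vec d) (n : ℕ) (t : ℝ) :
    P.real {ω | t ≤ signExponent π R f x0 n ω} ≤ Real.exp (-t) := by
  simpa only [signExponent, NNReal.coe_one, one_mul] using
    measureReal_le_sum_mul_sub_sq_le_exp_neg hR.sign_meas hR.hasSubgaussianMGF_sign hR.sign_indep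
      (fun k => (hR.measurable_curvSlope hf π x0 k).const_mul (tilt π)) n t

theorem one_sub_le_measureReal_stopTime_lt (hπ : π.Valid) (hf : IsObjective f π.L π.M fbar)
    (hR : IsRandomized P ℱ R) (hδ : 0 < δ) (hδ1 : δ < 1)
    (hacc : ∀ᵐ ω ∂P, ∀ k : ℕ, (k : ℕ∞) ≤ stopTime π R ω → AccurateStep π R f x0 k ω) :
    1 - δ ≤ P.real {ω | ∃ k : ℕ, stopTime π R ω = k ∧
      (k : ℝ) < 2 * ((f x0 - fbar) / constCeps π) +
        constB π * (constC π * Real.log (1 / δ))} := by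
  set bound := 2 * ((f x0 - fbar) / constCeps π) + constB π * (constC π * Real.log (1 / δ))
  have hlog : 0 ≤ Real.log (1 / δ) := Real.log_nonneg ((one_le_div hδ).2 hδ1.le)
  set bad := {ω | Real.log (1 / δ) ≤ signExponent π R f x0 ⌈bound⌉₊ ω}
  have hbad : P.real bad ≤ δ := by
    refine (hR.measureReal_le_signExponent_le hf π x0 _ _).trans_eq ?_
    rw [one_div, Real.log_inv, neg_neg, Real.exp_log hδ]
  have hgood : badᶜ ≤ᵐ[P] {ω | ∃ k : ℕ, stopTime π R ω = k ∧ (k : ℝ) < bound} := by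
    filter_upwards [hacc, hR.ae_sign] with ω hω hsign hnotbad
    by_contra hlate
    have hret : ∀ j < ⌈bound⌉₊, ¬ Returns π R j ω := fun j hj hreturn => by
      obtain ⟨k, hk, hkj⟩ := exists_stopTime_eq_of_returns hreturn
      exact hlate ⟨k, hk, Nat.lt_ceil.1 (hkj.trans_lt hj)⟩
    exact hnotbad (le_signExponent_of_not_returns hπ hf hlog (Nat.le_ceil _)
      (fun k hk => hω k ((Nat.cast_le.2 hk.le).trans (le_stopTime hret))) hsign hret)
  have hcompl : 1 ≤ P.real bad + P.real badᶜ := by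
    rw [← probReal_univ (μ := P), ← Set.union_compl_self bad]
    exact measureReal_union_le _ _
  have hmono : P.real badᶜ ≤ P.real {ω | ∃ k : ℕ, stopTime π R ω = k ∧ (k : ℝ) < bound} :=
    ENNReal.toReal_mono (measure_ne_top _ _) (measure_mono_ae hgood)
  linarith

end ReturnProbability

end Run

section ShortSteps

variable {L M ε : ℝ}

lemma Params.Valid.constK_nonneg {π : Params} (hπ : π.Valid) (η : ℕ) (Δ δ : ℝ) :
    0 ≤ constK π η Δ δ := by
  have := hπ.constC_pos
  have := zero_le_one.trans hπ.one_le_constB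
  exact le_max_of_le_right (le_max_of_le_right (by positivity))

lemma Params.Valid.iterBound_nonneg {π : Params} {Δ : ℝ} (hπ : π.Valid) (η : ℕ) (hΔ : 0 ≤ Δ)
    (δ : ℝ) : 0 ≤ iterBound π η Δ δ := by
  have := hπ.constCeps_pos
  have := zero_le_one.trans hπ.one_le_constB
  have := hπ.constK_nonneg η Δ δ
  unfold iterBound
  positivity

lemma Params.Valid.le_iterBound {π : Params} (hπ : π.Valid) (η : ℕ) (Δ δ : ℝ) :
    2 * (Δ / constCeps π) + constB π * (constC π * Real.log (1 / δ)) ≤ iterBound π η Δ δ := by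
  have := zero_le_one.trans hπ.one_le_constB
  unfold iterBound
  gcongr
  exact le_max_left _ _

lemma valid_shortStepParams (hL : 0 < L) (hM : 0 < M) (hε : 0 < ε) :
    (shortStepParams L M ε).Valid where
  epsG_pos := hε
  epsH_pos := Real.sqrt_pos.2 (mul_pos hε hM)
  L_pos := hL
  M_pos := hM
  epsH_le_alpha := le_rfl

lemma constC_shortStepParams (L : ℝ) (hM : 0 < M) (hε : 0 < ε) :
    constC (shortStepParams L M ε) = 2304 := by
  have hsq : √(ε * M) ^ 2 = ε * M := Real.sq_sqrt (by positivity)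
  have hpow : √(ε * M) ^ 6 = (ε * M) ^ 3 := by
    rw [show 6 = 2 * 3 from rfl, pow_mul, hsq]
  simp only [constC, shortStepParams, hsq, hpow]
  field_simp

lemma constB_shortStepParams (L : ℝ) (hM : 0 < M) (hε : 0 < ε) :
    constB (shortStepParams L M ε) = 1 + 18 * L / √M * (1 / √ε) := by
  have := Real.sqrt_pos.2 hM
  have := Real.sqrt_pos.2 hε
  calc constB (shortStepParams L M ε)
      = 1 + 18 * (√ε * √M) * L / (√M ^ 2 * √ε ^ 2) := by
        rw [Real.sq_sqrt hM.le, Real.sq_sqrt hε.le, ← Real.sqrt_mul hε.le]; rfl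
    _ = 1 + 18 * L / √M * (1 / √ε) := by field_simp

lemma exists_constB_shortStepParams_le (hL : 0 < L) (hM : 0 < M) :
    ∃ b : ℝ, 0 < b ∧ ∀ ε : ℝ, 0 < ε → ε ≤ 1 →
      constB (shortStepParams L M ε) ≤ b * (1 / ε ^ (1 / 2 : ℝ)) := by
  have := Real.sqrt_pos.2 hM
  refine ⟨1 + 18 * L / √M, by positivity, fun ε hε hε1 => ?_⟩
  have hone : 1 ≤ 1 / √ε := (one_le_div (Real.sqrt_pos.2 hε)).2 (Real.sqrt_le_one.2 hε1)
  rw [constB_shortStepParams L hM hε, ← Real.sqrt_eq_rpow, add_mul, one_mul]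
  gcongr

lemma exists_le_constCeps_shortStepParams (hL : 0 < L) (hM : 0 < M) :
    ∃ m : ℝ, 0 < m ∧ ∀ ε : ℝ, 0 < ε → ε ≤ 1 →
      m * ε ^ 2 ≤ constCeps (shortStepParams L M ε) := by
  have := Real.sqrt_pos.2 hM
  refine ⟨min (1 / (6 * L)) (2 * √M ^ 3 / (9 * M ^ 2)), lt_min (by positivity) (by positivity),
    fun ε hε hε1 => le_min ?_ ?_⟩
  · calc min (1 / (6 * L)) (2 * √M ^ 3 / (9 * M ^ 2)) * ε ^ 2
        ≤ 1 / (6 * L) * ε ^ 2 := by gcongr; exact min_le_left _ _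
      _ = ε ^ 2 / (6 * L) := by ring
  · have hpow : ε ^ 2 ≤ √ε ^ 3 :=
      calc ε ^ 2 = √ε ^ 4 := by rw [show 4 = 2 * 2 from rfl, pow_mul, Real.sq_sqrt hε.le]
        _ ≤ √ε ^ 3 := pow_le_pow_of_le_one (Real.sqrt_nonneg ε) (Real.sqrt_le_one.2 hε1)
            (by norm_num)
    calc min (1 / (6 * L)) (2 * √M ^ 3 / (9 * M ^ 2)) * ε ^ 2
        ≤ 2 * √M ^ 3 / (9 * M ^ 2) * √ε ^ 3 := by gcongr; exact min_le_right _ _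
      _ = 2 * √(ε * M) ^ 3 / (9 * M ^ 2) := by rw [Real.sqrt_mul hε.le]; ring

lemma exists_div_constCeps_shortStepParams_le (hL : 0 < L) (hM : 0 < M) :
    ∃ q : ℝ, 0 < q ∧ ∀ ε : ℝ, 0 < ε → ε ≤ 1 → ∀ Δ : ℝ, 0 ≤ Δ →
      Δ / constCeps (shortStepParams L M ε) ≤ q * Δ * (1 / ε ^ 2) := by
  obtain ⟨m, hm, hceps⟩ := exists_le_constCeps_shortStepParams hL hM
  refine ⟨1 / m, by positivity, fun ε hε hε1 Δ hΔ => ?_⟩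
  calc Δ / constCeps (shortStepParams L M ε) ≤ Δ / (m * ε ^ 2) := by gcongr; exact hceps ε hε hε1
    _ = 1 / m * Δ * (1 / ε ^ 2) := by field_simp

lemma rpow_one_div_le_of_le_sq {y z : ℝ} {η : ℕ} (hη : 2 ≤ η) (hy : 0 ≤ y) (hz : 1 ≤ z)
    (hyz : y ≤ z ^ 2) : y ^ (1 / (η : ℝ)) ≤ z := by
  have hη' : (2 : ℝ) ≤ η := by exact_mod_cast hη
  calc y ^ (1 / (η : ℝ)) ≤ (z ^ 2) ^ (1 / (η : ℝ)) := by gcongr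
    _ ≤ (z ^ 2) ^ (1 / 2 : ℝ) := by
        gcongr
        exact one_le_pow₀ hz
    _ = z := by rw [← Real.sqrt_eq_rpow, Real.sqrt_sq (zero_le_one.trans hz)]

lemma rpow_one_div_sub_one_le {y : ℝ} {η : ℕ} (hη : 2 ≤ η) (hy : 1 ≤ y) :
    y ^ (1 / ((η : ℝ) - 1)) ≤ y := by
  have hη' : (2 : ℝ) ≤ η := by exact_mod_cast hη
  refine (Real.rpow_le_rpow_of_exponent_le hy ?_).trans_eq (Real.rpow_one y)
  rw [div_le_one (by linarith)]
  linarith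

lemma exists_rpow_div_constCeps_shortStepParams_le {η : ℕ} (hη : 2 ≤ η) (hL : 0 < L)
    (hM : 0 < M) :
    ∃ q : ℝ, 0 < q ∧ ∀ ε : ℝ, 0 < ε → ε ≤ 1 → ∀ Δ : ℝ, 0 ≤ Δ →
      (Δ / constCeps (shortStepParams L M ε)) ^ (1 / (η : ℝ)) ≤ q * (1 + Δ) * (1 / ε) := by
  obtain ⟨q, hq, hquot⟩ := exists_div_constCeps_shortStepParams_le hL hM
  refine ⟨1 + q, by positivity, fun ε hε hε1 Δ hΔ => ?_⟩
  have hinv : 1 ≤ 1 / ε := (one_le_div hε).2 hε1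
  have hS : 1 ≤ (1 + q) * (1 + Δ) := by nlinarith
  refine rpow_one_div_le_of_le_sq hη
    (div_nonneg hΔ (valid_shortStepParams hL hM hε).constCeps_pos.le)
    (one_le_mul_of_one_le_of_one_le hS hinv) ?_
  calc Δ / constCeps (shortStepParams L M ε) ≤ q * Δ * (1 / ε ^ 2) := hquot ε hε hε1 Δ hΔ
    _ ≤ ((1 + q) * (1 + Δ)) ^ 2 * (1 / ε ^ 2) := by gcongr; nlinarith
    _ = ((1 + q) * (1 + Δ) * (1 / ε)) ^ 2 := by ring

lemma constB_shortStepParams_le_mul_one_div {b : ℝ} (hb : 0 ≤ b) (hε : 0 < ε) (hε1 : ε ≤ 1)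
    (hB : constB (shortStepParams L M ε) ≤ b * (1 / ε ^ (1 / 2 : ℝ))) :
    constB (shortStepParams L M ε) ≤ b * (1 / ε) :=
  hB.trans <| mul_le_mul_of_nonneg_left
    (one_div_le_one_div_of_le hε (Real.self_le_rpow_of_le_one hε.le hε1 (by norm_num))) hb

lemma exists_constK_shortStepParams_le {η : ℕ} (hη : 2 ≤ η) (hL : 0 < L) (hM : 0 < M) :
    ∃ κ : ℝ, 0 < κ ∧ ∀ ε : ℝ, 0 < ε → ε ≤ 1 → ∀ Δ δ : ℝ, 0 ≤ Δ → 0 < δ → δ < 1 →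
      constK (shortStepParams L M ε) η Δ δ ≤ κ * ((1 + Δ + Real.log (1 / δ)) * (1 / ε)) := by
  obtain ⟨q, hq, hquot⟩ := exists_rpow_div_constCeps_shortStepParams_le hη hL hM
  obtain ⟨b, hb, hB⟩ := exists_constB_shortStepParams_le hL hM
  refine ⟨max 2304 (max (4 * η * 2304 * q) (4 * η ^ 2 * 2304 ^ (1 + 1 / ((η : ℝ) - 1)) * b)),
    lt_max_of_lt_left (by norm_num), fun ε hε hε1 Δ δ hΔ hδ hδ1 => ?_⟩
  have hlog : 0 ≤ Real.log (1 / δ) := Real.log_nonneg ((one_le_div hδ).2 hδ1.le)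
  have hinv : 1 ≤ 1 / ε := (one_le_div hε).2 hε1
  set S := 1 + Δ + Real.log (1 / δ)
  have hlogS : Real.log (1 / δ) ≤ S * (1 / ε) :=
    (by linarith : Real.log (1 / δ) ≤ S).trans (le_mul_of_one_le_right (by linarith) hinv)
  have hquotS : (Δ / constCeps (shortStepParams L M ε)) ^ (1 / (η : ℝ)) ≤ q * (S * (1 / ε)) := by
    refine (hquot ε hε hε1 Δ hΔ).trans ?_
    rw [mul_assoc]
    gcongr
    linarith
  have hBS : constB (shortStepParams L M ε) ^ (1 / ((η : ℝ) - 1)) ≤ b * (S * (1 / ε)) :=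
    calc constB (shortStepParams L M ε) ^ (1 / ((η : ℝ) - 1))
        ≤ constB (shortStepParams L M ε) :=
          rpow_one_div_sub_one_le hη (valid_shortStepParams hL hM hε).one_le_constB
      _ ≤ b * (1 / ε) := constB_shortStepParams_le_mul_one_div hb.le hε hε1 (hB ε hε hε1)
      _ ≤ b * (S * (1 / ε)) := by
          gcongr; exact le_mul_of_one_le_left (by positivity) (by linarith)
  rw [max_mul_of_nonneg _ _ (by positivity), max_mul_of_nonneg _ _ (by positivity), constK,
    constC_shortStepParams L hM hε, mul_assoc _ q, mul_assoc _ b]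
  gcongr

lemma exists_iterBound_shortStepParams_le {η : ℕ} (hη : 2 ≤ η) (hL : 0 < L) (hM : 0 < M) :
    ∃ c : ℝ, 0 < c ∧ ∀ ε : ℝ, 0 < ε → ε ≤ 1 → ∀ Δ δ : ℝ, 0 ≤ Δ → 0 < δ → δ < 1 →
      iterBound (shortStepParams L M ε) η Δ δ ≤
        c * ((1 + Δ + Real.log (1 / δ)) * (1 / ε ^ 2)) := by
  obtain ⟨q, hq, hquot⟩ := exists_div_constCeps_shortStepParams_le hL hM
  obtain ⟨b, hb, hB⟩ := exists_constB_shortStepParams_le hL hM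
  obtain ⟨κ, hκ, hK⟩ := exists_constK_shortStepParams_le hη hL hM
  refine ⟨2 * q + b * κ, by positivity, fun ε hε hε1 Δ δ hΔ hδ hδ1 => ?_⟩
  have hlog : 0 ≤ Real.log (1 / δ) := Real.log_nonneg ((one_le_div hδ).2 hδ1.le)
  set S := 1 + Δ + Real.log (1 / δ)
  have hBε : constB (shortStepParams L M ε) ≤ b * (1 / ε) :=
    constB_shortStepParams_le_mul_one_div hb.le hε hε1 (hB ε hε hε1)
  calc iterBound (shortStepParams L M ε) η Δ δ
      ≤ 2 * (q * Δ * (1 / ε ^ 2)) + b * (1 / ε) * (κ * (S * (1 / ε))) := by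
        unfold iterBound
        gcongr
        · exact hquot ε hε hε1 Δ hΔ
        · exact (valid_shortStepParams hL hM hε).constK_nonneg η Δ δ
        · exact hK ε hε hε1 Δ δ hΔ hδ hδ1
    _ ≤ 2 * (q * S * (1 / ε ^ 2)) + b * (1 / ε) * (κ * (S * (1 / ε))) := by gcongr; linarith
    _ = (2 * q + b * κ) * (S * (1 / ε ^ 2)) := by field_simp

theorem exists_abs_constants_shortStepParams_le {η : ℕ} (hη : 2 ≤ η) (hL : 0 < L) (hM : 0 < M) :
    ∃ c : ℝ, 0 < c ∧ ∀ ε : ℝ, 0 < ε → ε ≤ 1 →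
      |constC (shortStepParams L M ε)| ≤ c ∧
      |constB (shortStepParams L M ε)| ≤ c * (1 / ε ^ (1 / 2 : ℝ)) ∧
      ∀ Δ δ : ℝ, 0 ≤ Δ → 0 < δ → δ < 1 →
        |constK (shortStepParams L M ε) η Δ δ| ≤
          c * (1 + Δ + Real.log (1 / δ)) * (1 / ε) ∧
        |iterBound (shortStepParams L M ε) η Δ δ| ≤
          c * (1 + Δ + Real.log (1 / δ)) * (1 / ε ^ 2) := by
  obtain ⟨b, hb, hB⟩ := exists_constB_shortStepParams_le hL hM
  obtain ⟨κ, hκ, hK⟩ := exists_constK_shortStepParams_le hη hL hM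
  obtain ⟨ν, hν, hn⟩ := exists_iterBound_shortStepParams_le hη hL hM
  refine ⟨2304 + b + κ + ν, by positivity, fun ε hε hε1 => ?_⟩
  have hπ := valid_shortStepParams hL hM hε
  refine ⟨?_, ?_, fun Δ δ hΔ hδ hδ1 => ?_⟩
  · rw [constC_shortStepParams L hM hε, abs_of_pos (by norm_num)]
    linarith
  · rw [abs_of_nonneg (zero_le_one.trans hπ.one_le_constB)]
    refine (hB ε hε hε1).trans ?_
    gcongr
    linarith
  · have hlog : 0 ≤ Real.log (1 / δ) := Real.log_nonneg ((one_le_div hδ).2 hδ1.le)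
    rw [abs_of_nonneg (hπ.constK_nonneg η Δ δ), abs_of_nonneg (hπ.iterBound_nonneg η hΔ δ),
      mul_assoc, mul_assoc]
    refine ⟨(hK ε hε hε1 Δ δ hΔ hδ hδ1).trans ?_, (hn ε hε hε1 Δ δ hΔ hδ hδ1).trans ?_⟩ <;>
      gcongr <;> linarith

variable {d : ℕ} {Ω : Type*} {f : Vec d → ℝ} {R : RunData d Ω} {x0 : Vec d} {ω : Ω}

lemma mem_Icc_of_negCurvStep_shortStepParams {k : ℕ}
    (hN : NegCurvStep (shortStepParams L M ε) R k ω) :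
    √(ε * M) ∈ Set.Icc √(ε * M) (min √(ε * M) |lambdaHat R k ω|) := by
  have hlambda : lambdaHat R k ω < -√(ε * M) := hN.2
  exact ⟨le_rfl, le_min le_rfl ((lt_neg.1 hlambda).le.trans (neg_le_abs _))⟩

lemma admissibleSteps_shortStepParams (hstep : ∀ k ω, R.stepSize k ω = √(ε * M))
    (hL : √(ε * M) ≤ L) : AdmissibleSteps (shortStepParams L M ε) R :=
  ⟨⟨le_rfl, hL⟩, fun k ω hN => hstep k ω ▸ mem_Icc_of_negCurvStep_shortStepParams hN⟩

lemma accurateStep_shortStepParams {k : ℕ} (hstep : R.stepSize k ω = √(ε * M))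
    (hk : (k : ℕ∞) ≤ stopTime (shortStepParams L M ε) R ω)
    (hg : AccurateGradients (shortStepParams L M ε) R f x0 ω)
    (hH : AccurateHessians (shortStepParams L M ε) R f x0 ω)
    (hp : AccurateEigenpairs (shortStepParams L M ε) R ω) :
    AccurateStep (shortStepParams L M ε) R f x0 k ω where
  gradient := hg k hk
  hessian hN := (hH k hk hN.1).2
  norm_direction hN := (hp k hk hN.1).1
  stepSize_mem hN := hstep ▸ mem_Icc_of_negCurvStep_shortStepParams hN

lemma ae_accurateStep_shortStepParams [MeasurableSpace Ω] {P : Measure Ω}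
    (hstep : ∀ k ω, R.stepSize k ω = √(ε * M))
    (hg : ∀ᵐ ω ∂P, AccurateGradients (shortStepParams L M ε) R f x0 ω)
    (hH : ∀ᵐ ω ∂P, AccurateHessians (shortStepParams L M ε) R f x0 ω)
    (hp : ∀ᵐ ω ∂P, AccurateEigenpairs (shortStepParams L M ε) R ω) :
    ∀ᵐ ω ∂P, ∀ k : ℕ, (k : ℕ∞) ≤ stopTime (shortStepParams L M ε) R ω →
      AccurateStep (shortStepParams L M ε) R f x0 k ω := by
  filter_upwards [hg, hH, hp] with ω hgω hHω hpω k hk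
  exact accurateStep_shortStepParams (hstep k ω) hk hgω hHω hpω

end ShortSteps

end RandNC

theorem mainTheorem3_general (L M : ℝ) (hL : 0 < L) (hM : 0 < M) (η : ℕ) (hη : 2 ≤ η) :
    (∃ c : ℝ, 0 < c ∧ ∀ ε : ℝ, 0 < ε → ε ≤ 1 →
      |RandNC.constC (RandNC.shortStepParams L M ε)| ≤ c ∧
      |RandNC.constB (RandNC.shortStepParams L M ε)| ≤ c * (1 / ε ^ (1 / 2 : ℝ)) ∧
      ∀ Δ δ : ℝ, 0 ≤ Δ → 0 < δ → δ < 1 →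
        |RandNC.constK (RandNC.shortStepParams L M ε) η Δ δ|
          ≤ c * (1 + Δ + Real.log (1 / δ)) * (1 / ε) ∧
        |RandNC.iterBound (RandNC.shortStepParams L M ε) η Δ δ|
          ≤ c * (1 + Δ + Real.log (1 / δ)) * (1 / ε ^ 2)) ∧
    (∀ (π : RandNC.Params) (δ : ℝ), π.Valid → π.L = L → π.M = M → 0 < δ → δ < 1 →
      ∀ (d : ℕ) (f : RandNC.Vec d → ℝ) (fbar : ℝ) (x0 : RandNC.Vec d),
      RandNC.IsObjective f L M fbar →
      ∀ (Ω : Type*) [mΩ : MeasurableSpace Ω] (P : MeasureTheory.Measure Ω)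
        [MeasureTheory.IsProbabilityMeasure P]
        (ℱ : MeasureTheory.Filtration ℕ mΩ) (R : RandNC.RunData d Ω),
      RandNC.IsRandomized P ℱ R →
      (∀ᵐ ω ∂P, ∀ k : ℕ, (k : ℕ∞) ≤ RandNC.stopTime π R ω →
        RandNC.AccurateStep π R f x0 k ω) →
        1 - δ ≤ P.real {ω | ∃ k : ℕ, RandNC.stopTime π R ω = (k : ℕ∞) ∧
          (k : ℝ) < 2 * ((f x0 - fbar) / RandNC.constCeps π) +
            RandNC.constB π * (RandNC.constC π * Real.log (1 / δ))}) := by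
  refine ⟨RandNC.exists_abs_constants_shortStepParams_le hη hL hM, ?_⟩
  rintro π δ hπ rfl rfl hδ hδ1 d f fbar x0 hf Ω mΩ P _ ℱ R hR hacc
  exact RandNC.one_sub_le_measureReal_stopTime_lt hπ hf hR hδ hδ1 hacc

theorem mainTheorem3 (L M : ℝ) (hL : 0 < L) (hM : 0 < M) :
    -- growth of the constants as functions of `ε`, with `η = 2`
    (∃ c : ℝ, 0 < c ∧ ∀ ε : ℝ, 0 < ε → ε ≤ 1 →
      |RandNC.constC (RandNC.shortStepParams L M ε)| ≤ c ∧
      |RandNC.constB (RandNC.shortStepParams L M ε)| ≤ c * (1 / ε ^ (1 / 2 : ℝ)) ∧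
      ∀ Δ δ : ℝ, 0 ≤ Δ → 0 < δ → δ < 1 →
        |RandNC.constK (RandNC.shortStepParams L M ε) 2 Δ δ|
          ≤ c * (1 + Δ + Real.log (1 / δ)) * (1 / ε) ∧
        |RandNC.iterBound (RandNC.shortStepParams L M ε) 2 Δ δ|
          ≤ c * (1 + Δ + Real.log (1 / δ)) * (1 / ε ^ 2)) ∧
    -- the algorithm with `α_k = ε_H` for all `k`
    (∀ (ε δ : ℝ), 0 < ε → 0 < δ → δ < 1 →
      ∀ (d : ℕ) (f : RandNC.Vec d → ℝ) (fbar : ℝ) (x0 : RandNC.Vec d),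
      RandNC.IsObjective f L M fbar →
      ∀ (Ω : Type*) [mΩ : MeasurableSpace Ω] (P : MeasureTheory.Measure Ω)
        [MeasureTheory.IsProbabilityMeasure P]
        (ℱ : MeasureTheory.Filtration ℕ mΩ) (R : RandNC.RunData d Ω),
      (∀ k ω, R.stepSize k ω = √(ε * M)) →
      RandNC.IsRandomized P ℱ R →
      (∀ᵐ ω ∂P, RandNC.AccurateGradients (RandNC.shortStepParams L M ε) R f x0 ω) →
      (∀ᵐ ω ∂P, RandNC.AccurateHessians (RandNC.shortStepParams L M ε) R f x0 ω) →
      (∀ᵐ ω ∂P, RandNC.AccurateEigenpairs (RandNC.shortStepParams L M ε) R ω) →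
        (√(ε * M) ≤ L → RandNC.AdmissibleSteps (RandNC.shortStepParams L M ε) R) ∧
        1 - δ ≤ P.real {ω | ∃ k : ℕ,
          RandNC.stopTime (RandNC.shortStepParams L M ε) R ω = (k : ℕ∞) ∧
          (k : ℝ) < RandNC.iterBound (RandNC.shortStepParams L M ε) 2 (f x0 - fbar) δ}) := by
  obtain ⟨hgrowth, hreturn⟩ := mainTheorem3_general L M hL hM 2 le_rfl
  refine ⟨hgrowth, fun ε δ hε hδ hδ1 d f fbar x0 hf Ω mΩ P _ ℱ R hstep hR hg hH hp =>
    ⟨RandNC.admissibleSteps_shortStepParams hstep, ?_⟩⟩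
  have hπ := RandNC.valid_shortStepParams hL hM hε
  refine (hreturn _ δ hπ rfl rfl hδ hδ1 d f fbar x0 hf Ω P ℱ R hR
    (RandNC.ae_accurateStep_shortStepParams hstep hg hH hp)).trans
      (MeasureTheory.measureReal_mono ?_)
  exact fun ω ⟨k, hk, hlt⟩ => ⟨k, hk, hlt.trans_le (hπ.le_iterBound 2 _ δ)⟩
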